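/- Let $\Lambda$ be an Artin algebra, i.e. an algebra over a commutative Artinian ring $R$ that is finitely generated as an $R$-module. Let $\operatorname{mod}\Lambda$ be the abelian category of finitely generated $\Lambda$-modules, assume that $\Lambda$ has finite global dimension (there is $d$ with $\operatorname{Ext}^i(X,Y)=0$ for all $i>d$ and all $X,Y\in\operatorname{mod}\Lambda$), and let $n$ be the number of isomorphism classes of simple $\Lambda$-modules. Let $m>0$ be an integer. An $m$-periodic complex over $\operatorname{mod}\Lambda$ is a family $(V^i,\ d^i\colon V^i\to V^{i+1})_{i\in\mathbb Z/m}$ of objects and morphisms of $\operatorname{mod}\Lambda$ with $d^{i+1}d^i=0$; chain maps, homotopies, cohomology $H^i$, quasi-isomorphisms, the shift $V[1]=(V^{i+1},-d^{i+1})_{i\in\mathbb Z/m}$ and mapping cones are defined as for ordinary complexes, with indices in $\mathbb Z/m$. The $m$-periodic derived category $D_m(\operatorname{mod}\Lambda)$ is the localization of the homotopy category of $m$-periodic complexes with respect to quasi-isomorphisms; its exact triangles are those isomorphic to the image of $V\xrightarrow{f}W\to\operatorname{Cone}(f)\to V[1]$ for a chain map $f$. Its Grothendieck group $K_0(D_m(\operatorname{mod}\Lambda))$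 is the free abelian group on isomorphism classes of objects modulo the relations $[X]-[Y]+[Z]=0$ for all exact triangles $X\to Y\to Z\to X[1]$. Then there is an isomorphism of abelian groups $$K_0(D_m(\operatorname{mod}\Lambda))\cong\begin{cases}\mathbb Z^{n}&\text{if } m \text{ is even},\\ \mathbb F_2^{\,n}&\text{if } m\text{ is odd}.\end{cases}$$ -/

import Mathlib

open CategoryTheory CategoryTheory.Limits HomologicalComplex

universe v u

section PeriodicComplexes

/-- An `m`-periodic complex in `C`: objects `V.X i` for `i : ZMod m` and differentials
`V.d i (i + 1)` with `d ∘ d = 0`. Morphisms are chain maps. -/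
abbrev PeriodicComplex (C : Type u) [Category.{v} C] [Preadditive C] (m : ℕ) :=
  HomologicalComplex C (ComplexShape.up (ZMod m))

variable (C : Type u) [Category.{v} C] [Preadditive C] (m : ℕ)

namespace PeriodicComplex

lemma rel_add (n : ℤ) (i j : ZMod m) :
    (ComplexShape.up (ZMod m)).Rel (i + n) (j + n) ↔ (ComplexShape.up (ZMod m)).Rel i j := by
  simp only [ComplexShape.up_Rel]
  rw [add_right_comm]
  exact add_left_inj _

/-- The shift by `n`: `(V[n])^i = V^{i+n}`, with differential `(-1)^n d`. -/
@[simps]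
def shiftFunctor (n : ℤ) : PeriodicComplex C m ⥤ PeriodicComplex C m where
  obj K :=
    { X := fun i => K.X (i + n)
      d := fun _ _ => n.negOnePow • K.d _ _
      d_comp_d' := by
        intros
        simp only [Linear.comp_units_smul, Linear.units_smul_comp, d_comp_d, smul_zero]
      shape := fun i j hij => by
        rw [K.shape _ _ (fun h => hij ((rel_add m n i j).1 h)), smul_zero] }
  map φ :=
    { f := fun _ => φ.f _
      comm' := by
        intros
        simp only [Linear.comp_units_smul, Hom.comm, Linear.units_smul_comp] }
  map_id := by intros; rfl
  map_comp := by intros; rfl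

/-- The shift by `0` is the identity. -/
def shiftFunctorZero' : shiftFunctor C m 0 ≅ 𝟭 _ :=
  NatIso.ofComponents (fun K => Hom.isoOfComponents
    (fun i => K.XIsoOfEq (by simp))
    (fun i j _ => by simp [shiftFunctor])) (fun f ↦ by
      ext i
      exact XIsoOfEq_hom_naturality f (show i + ((0 : ℤ) : ZMod m) = i by simp))

/-- The shift by `a + b` is the composition of the shifts by `a` and by `b`. -/
def shiftFunctorAdd' (a b : ℤ) :
    shiftFunctor C m (a + b) ≅ shiftFunctor C m a ⋙ shiftFunctor C m b :=
  NatIso.ofComponents (fun K => Hom.isoOfComponents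
    (fun i => K.XIsoOfEq (show i + ((a + b : ℤ) : ZMod m) = i + b + a by push_cast; ring))
    (fun i j _ => by
      dsimp [shiftFunctor]
      simp only [add_comm a b, Int.negOnePow_add, Linear.units_smul_comp,
        Linear.comp_units_smul, d_comp_XIsoOfEq_hom, smul_smul, XIsoOfEq_hom_comp_d]))
    (fun f ↦ by
      ext i
      exact XIsoOfEq_hom_naturality f
        (show i + ((a + b : ℤ) : ZMod m) = i + b + a by push_cast; ring))



lemma shiftFunctorZero'_hom_app_f (K : PeriodicComplex C m) (i : ZMod m) :
    ((shiftFunctorZero' C m).hom.app K).f i =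
      eqToHom (congrArg K.X (show i + ((0 : ℤ) : ZMod m) = i by simp)) := rfl

lemma shiftFunctorZero'_inv_app_f (K : PeriodicComplex C m) (i : ZMod m) :
    ((shiftFunctorZero' C m).inv.app K).f i =
      eqToHom (congrArg K.X (show i = i + ((0 : ℤ) : ZMod m) by simp)) := rfl

lemma shiftFunctorAdd'_hom_app_f (a b : ℤ) (K : PeriodicComplex C m) (i : ZMod m) :
    ((shiftFunctorAdd' C m a b).hom.app K).f i =
      eqToHom (congrArg K.X
        (show i + ((a + b : ℤ) : ZMod m) = i + b + a by push_cast; ring)) := rfl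

instance : HasShift (PeriodicComplex C m) ℤ := hasShiftMk _ _
  { F := shiftFunctor C m
    zero := shiftFunctorZero' C m
    add := fun a b => shiftFunctorAdd' C m a b
    assoc_hom_app := fun a b c K => by
      ext i
      rw [comp_f, comp_f, comp_f, eqToHom_f, shiftFunctorAdd'_hom_app_f,
        shiftFunctorAdd'_hom_app_f, shiftFunctorAdd'_hom_app_f]
      erw [shiftFunctorAdd'_hom_app_f, eqToHom_trans, eqToHom_trans, eqToHom_trans]
    zero_add_hom_app := fun n K => by
      ext i
      rw [comp_f, eqToHom_f, shiftFunctorAdd'_hom_app_f]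
      erw [shiftFunctorZero'_inv_app_f, eqToHom_trans]
      rfl
    add_zero_hom_app := fun n K => by
      ext i
      rw [comp_f, eqToHom_f, shiftFunctorAdd'_hom_app_f, shiftFunctorZero'_inv_app_f]
      erw [eqToHom_trans]
      rfl }


/-- The shift functor of the shift structure is the explicit shift. -/
lemma shift_eq (n : ℤ) :
    CategoryTheory.shiftFunctor (PeriodicComplex C m) n = shiftFunctor C m n := rfl

variable {C m}

/-- A homotopy between chain maps induces a homotopy between their shifts. -/
def homotopyShift {K L : PeriodicComplex C m} {f g : K ⟶ L} (h : Homotopy f g) (n : ℤ) :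
    Homotopy ((shiftFunctor C m n).map f) ((shiftFunctor C m n).map g) where
  hom i j := n.negOnePow • h.hom (i + n) (j + n)
  zero i j hij := by
    rw [h.zero _ _ (fun h' => hij ((rel_add m n j i).1 h')), smul_zero]
    rfl
  comm i := by
    have h₁ : (ComplexShape.up (ZMod m)).Rel i (i + 1) := rfl
    have h₂ : (ComplexShape.up (ZMod m)).Rel (i - 1) i := sub_add_cancel i 1
    have := h.comm (i + n)
    rw [dNext_eq _ ((rel_add m n _ _).2 h₁), prevD_eq _ ((rel_add m n _ _).2 h₂)] at this
    erw [dNext_eq _ h₁, prevD_eq _ h₂, shiftFunctor_obj_d, shiftFunctor_obj_d]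
    simp only [shiftFunctor_map_f]
    erw [Linear.units_smul_comp, Linear.comp_units_smul, Linear.units_smul_comp,
      Linear.comp_units_smul, smul_smul, smul_smul, Int.units_mul_self, one_smul, one_smul]
    exact this

instance : (homotopic C (ComplexShape.up (ZMod m))).IsCompatibleWithShift ℤ :=
  ⟨fun n _ _ _ _ ⟨h⟩ => ⟨homotopyShift h n⟩⟩

end PeriodicComplex

/-- The homotopy category of `m`-periodic complexes. -/
abbrev PeriodicHomotopyCategory := HomotopyCategory C (ComplexShape.up (ZMod m))

noncomputable instance : HasShift (PeriodicHomotopyCategory C m) ℤ :=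
  inferInstanceAs (HasShift (Quotient (homotopic C (ComplexShape.up (ZMod m)))) ℤ)

noncomputable instance : (HomotopyCategory.quotient C (ComplexShape.up (ZMod m))).CommShift ℤ :=
  Quotient.functor_commShift (homotopic C (ComplexShape.up (ZMod m))) ℤ

namespace PeriodicComplex

variable {C m}

/-- The canonical map `Cone f ⟶ V[1]`, the projection onto the first summand of
`(Cone f)^i = V^{i+1} ⊕ W^i`. -/
noncomputable def coneToShift [HasBinaryBiproducts C] {V W : PeriodicComplex C m} (f : V ⟶ W) :
    homotopyCofiber f ⟶ V⟦(1 : ℤ)⟧ where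
  f i := homotopyCofiber.fstX f i (i + ((1 : ℤ) : ZMod m)) (by simp)
  comm' i j hij := by
    have h₁ : (ComplexShape.up (ZMod m)).Rel i (i + ((1 : ℤ) : ZMod m)) := by simp
    have h₂ : (ComplexShape.up (ZMod m)).Rel j (j + ((1 : ℤ) : ZMod m)) := by simp
    obtain rfl : i + ((1 : ℤ) : ZMod m) = j := by simpa using hij
    have key : ((shiftFunctor C m 1).obj V).d i (i + ((1 : ℤ) : ZMod m)) =
        -V.d (i + ((1 : ℤ) : ZMod m)) (i + ((1 : ℤ) : ZMod m) + ((1 : ℤ) : ZMod m)) := by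
      simp
      rfl
    refine Eq.trans ?_ (homotopyCofiber.d_fstX f _ _ _ h₁ h₂).symm
    erw [key, Preadditive.comp_neg]
    rfl

/-- The standard triangle `V ⟶ W ⟶ Cone f ⟶ V[1]` attached to a chain map `f : V ⟶ W`. -/
noncomputable def coneTriangle [HasBinaryBiproducts C] {V W : PeriodicComplex C m} (f : V ⟶ W) :
    Pretriangulated.Triangle (PeriodicComplex C m) :=
  Pretriangulated.Triangle.mk f (homotopyCofiber.inr f) (coneToShift f)

end PeriodicComplex


section Derived

variable (A : Type u) [Category.{v} A] [Abelian A] (m : ℕ)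

namespace PeriodicComplex

variable {A m}

lemma units_smul_refl_comm (e : ℤˣ) {X Y : A} (f : X ⟶ Y) :
    (e • Iso.refl X).hom ≫ f = f ≫ (e • Iso.refl Y).hom := by
  simp

lemma units_smul_refl_comp (e : ℤˣ) {X Y : A} (f : X ⟶ Y) :
    (e • Iso.refl X).hom ≫ f = (e • f) ≫ (Iso.refl Y).hom := by
  simp

lemma units_smul_comp_refl (e : ℤˣ) {X Y : A} (f : X ⟶ Y) :
    (Iso.refl X).hom ≫ f = (e • f) ≫ (e • Iso.refl Y).hom := by
  simp [smul_smul]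

/-- The cohomology of `K[n]` in degree `i` is computed by the same short complex, up to signs,
as the cohomology of `K` in degree `i + n`. -/
noncomputable def shiftScIso (K : PeriodicComplex A m) (n : ℤ) (i : ZMod m) :
    ((shiftFunctor A m n).obj K).sc' (i - 1) i (i + 1) ≅
      K.sc' (i - 1 + n) (i + n) (i + 1 + n) :=
  ShortComplex.isoMk (n.negOnePow • Iso.refl (K.X (i - 1 + n))) (Iso.refl (K.X (i + n)))
    (n.negOnePow • Iso.refl (K.X (i + 1 + n)))
    (units_smul_refl_comp n.negOnePow (K.d (i - 1 + n) (i + n)))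
    (units_smul_comp_refl n.negOnePow (K.d (i + n) (i + 1 + n)))

lemma quasiIso_shift_iff {K L : PeriodicComplex A m} (f : K ⟶ L) (n : ℤ) :
    QuasiIso ((shiftFunctor A m n).map f) ↔ QuasiIso f := by
  have key (i : ZMod m) : QuasiIsoAt ((shiftFunctor A m n).map f) i ↔ QuasiIsoAt f (i + n) := by
    have h₁ : (ComplexShape.up (ZMod m)).Rel i (i + 1) := rfl
    have h₂ : (ComplexShape.up (ZMod m)).Rel (i - 1) i := sub_add_cancel i 1
    rw [quasiIsoAt_iff' _ _ _ _ ((ComplexShape.up (ZMod m)).prev_eq' h₂)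
        ((ComplexShape.up (ZMod m)).next_eq' h₁),
      quasiIsoAt_iff' _ _ _ _ ((ComplexShape.up (ZMod m)).prev_eq' ((rel_add m n _ _).2 h₂))
        ((ComplexShape.up (ZMod m)).next_eq' ((rel_add m n _ _).2 h₁))]
    refine ShortComplex.quasiIso_iff_of_arrow_mk_iso _ _
      (Arrow.isoMk (shiftScIso K n i) (shiftScIso L n i) ?_)
    ext
    · exact units_smul_refl_comm n.negOnePow (f.f (i - 1 + n))
    · exact (Category.id_comp (f.f (i + n))).trans (Category.comp_id (f.f (i + n))).symm
    · exact units_smul_refl_comm n.negOnePow (f.f (i + 1 + n))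
  simp only [quasiIso_iff, key]
  exact ⟨fun h j => by simpa using h (j - n), fun h i => h _⟩

instance : (HomotopyCategory.quasiIso A (ComplexShape.up (ZMod m))).IsCompatibleWithShift ℤ where
  condition n := by
    ext X Y f
    obtain ⟨K, rfl⟩ := HomotopyCategory.quotient_obj_surjective X
    obtain ⟨L, rfl⟩ := HomotopyCategory.quotient_obj_surjective Y
    obtain ⟨f, rfl⟩ := (HomotopyCategory.quotient _ _).map_surjective f
    rw [MorphismProperty.inverseImage_iff, HomotopyCategory.quotient_map_mem_quasiIso_iff,
      mem_quasiIso_iff, ← quasiIso_shift_iff f n, ← mem_quasiIso_iff,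
      ← HomotopyCategory.quotient_map_mem_quasiIso_iff]
    exact (HomotopyCategory.quasiIso A _).arrow_mk_iso_iff
      (Arrow.isoMk (((HomotopyCategory.quotient A (ComplexShape.up (ZMod m))).commShiftIso n).symm.app K)
        (((HomotopyCategory.quotient A (ComplexShape.up (ZMod m))).commShiftIso n).symm.app L)
        (((HomotopyCategory.quotient A
          (ComplexShape.up (ZMod m))).commShiftIso n).inv.naturality f).symm)

end PeriodicComplex

/-- The `m`-periodic derived category `D_m(A)`: the localization of the homotopy category of
`m`-periodic complexes with respect to quasi-isomorphisms. -/
abbrev PeriodicDerivedCategory :=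
  (HomotopyCategory.quasiIso A (ComplexShape.up (ZMod m))).Localization

namespace PeriodicDerivedCategory

/-- The exact triangles of `K_m(A)`: those isomorphic to the standard triangle
`V ⟶ W ⟶ Cone f ⟶ V[1]` of a chain map `f : V ⟶ W`. -/
def homotopyExactTriangles : Set (Pretriangulated.Triangle (PeriodicHomotopyCategory A m)) :=
  {T | ∃ (V W : PeriodicComplex A m) (f : V ⟶ W), Nonempty (T ≅
    (HomotopyCategory.quotient A (ComplexShape.up (ZMod m))).mapTriangle.obj
      (PeriodicComplex.coneTriangle f))}

/-- The exact triangles of `D_m(A)`: those isomorphic to the image of an exact triangle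
of `K_m(A)`. -/
def exactTriangles : Set (Pretriangulated.Triangle (PeriodicDerivedCategory A m)) :=
  {T | ∃ T' ∈ homotopyExactTriangles A m, Nonempty (T ≅
    (HomotopyCategory.quasiIso A (ComplexShape.up (ZMod m))).Q.mapTriangle.obj T')}

end PeriodicDerivedCategory

end Derived

end PeriodicComplexes

section GrothendieckGroup

variable {T : Type u} [Category.{v} T] [HasShift T ℤ] (S : Set (Pretriangulated.Triangle T))

/-- The class of an object in the free abelian group on the isomorphism classes of objects. -/
def freeIsoClass (X : T) : FreeAbelianGroup (Quotient (isIsomorphicSetoid T)) :=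
  FreeAbelianGroup.of (Quotient.mk _ X)

/-- The subgroup generated by `[X] - [Y] + [Z]` for the triangles `X ⟶ Y ⟶ Z ⟶ X[1]` in `S`. -/
def triangleRelations : AddSubgroup (FreeAbelianGroup (Quotient (isIsomorphicSetoid T))) :=
  AddSubgroup.closure {x | ∃ t ∈ S,
    x = freeIsoClass t.obj₁ - freeIsoClass t.obj₂ + freeIsoClass t.obj₃}

/-- The Grothendieck group of a category with shift whose exact triangles are those in `S`. -/
abbrev TriangulatedK0 := FreeAbelianGroup (Quotient (isIsomorphicSetoid T)) ⧸ triangleRelations S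

end GrothendieckGroup

/-- An abelian category has finite global dimension if, for some `d`, all `Ext^i(X, Y)` with
`i > d` vanish. -/
def HasFiniteGlobalDimension (A : Type u) [Category.{v} A] [Abelian A] : Prop :=
  ∃ d : ℕ, ∀ X : A, HasProjectiveDimensionLE X d

/-- Isomorphism of simple modules. -/
instance simpleModuleSetoid (Λ : Type u) [Ring Λ] :
    Setoid {M : ModuleCat.{u} Λ // IsSimpleModule Λ M} where
  r M N := Nonempty (M.1 ≃ₗ[Λ] N.1)
  iseqv := ⟨fun _ => ⟨LinearEquiv.refl _ _⟩, fun ⟨e⟩ => ⟨e.symm⟩, fun ⟨e⟩ ⟨e'⟩ => ⟨e.trans e'⟩⟩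

/-- The isomorphism classes of simple `Λ`-modules. -/
abbrev SimpleModuleClasses (Λ : Type u) [Ring Λ] := Quotient (simpleModuleSetoid Λ)

/-!
Write `[V]` for the class of a periodic complex in `K₀` of the periodic derived category, and `S[0]`
for the complex with `S` in degree zero and zero elsewhere. The classes `[S[0]]` of the simple
modules `S` generate `K₀`, and Euler characteristics of composition multiplicities separate them.

*Generation.* For a short exact sequence of complexes `0 ⟶ K ⟶ L ⟶ M ⟶ 0` the map from the cone of
`K ⟶ L` to `M` is a quasi-isomorphism, as its kernel is the contractible cone of the identity of `K`
(`quasiIso_coneDesc`). Hence `[L] = [K] + [M]` (`PeriodicComplex.k0Class_of_shortExact`). A nonzero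
complex of modules of finite length has a nonzero cocycle, so it contains a stalk complex of a
simple module; induction on the total length shows that `K₀` is generated by simple stalk complexes
(`k0Class_mem_of_single_mem`). Moving a stalk complex by one degree changes the sign of its class,
as the cone of `V ⟶ 0` is `V[1]`; so degree zero suffices, and for odd `m` going once around `ℤ/m`
gives `2 [S[0]] = 0` (`PeriodicComplex.two_smul_k0Class_single`).

*Independence.* Let `k` be `ℤ` with signs `ε i = (-1) ^ i` if `m` is even, and `𝔽₂` with `ε i = 1` if
`m` is odd, so that `ε (i + 1) = - ε i` on `ℤ/m`. For the multiplicity `μ` of a simple module as a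
composition factor, which is additive by the Jordan–Hölder theorem (`HasFactors.unique`), the sum
`∑ ε i μ (Hⁱ V)` depends only on the isomorphism class of `V` in the derived category. It equals
`∑ ε i μ (Vⁱ)` (`sum_homology_eq_sum_X`), which visibly is additive on cones. This defines
`eulerCharacteristic` on `K₀`, and it sends the classes `[S[0]]` to the standard basis of `kⁿ`.
-/

/-! ### Composition factors of modules of finite length -/

section CompositionFactors

variable {Λ : Type u} [Ring Λ]

/-- The isomorphism class of a simple module. -/
def simpleClass (T : Type u) [AddCommGroup T] [Module Λ T] (hT : IsSimpleModule Λ T) :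
    SimpleModuleClasses Λ :=
  Quotient.mk _ ⟨ModuleCat.of Λ T, hT⟩

lemma simpleClass_eq {T T' : Type u} [AddCommGroup T] [Module Λ T] [AddCommGroup T']
    [Module Λ T'] (hT : IsSimpleModule Λ T) (hT' : IsSimpleModule Λ T') (e : T ≃ₗ[Λ] T') :
    simpleClass T hT = simpleClass T' hT' :=
  Quotient.sound ⟨e⟩

variable (Λ) in
/-- `HasFactors Λ M s`: the module `M` has a composition series whose factors, counted with
multiplicity, form the multiset `s`. The series is built from the top: either `M = 0`, or `M` has a
simple quotient whose kernel has a composition series. -/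
inductive HasFactors : ∀ (M : Type u) [AddCommGroup M] [Module Λ M],
    Multiset (SimpleModuleClasses Λ) → Prop
  | zero {M : Type u} [AddCommGroup M] [Module Λ M] [Subsingleton M] : HasFactors M 0
  | cons {M T : Type u} [AddCommGroup M] [Module Λ M] [AddCommGroup T] [Module Λ T]
      (g : M →ₗ[Λ] T) (hg : Function.Surjective g) (hT : IsSimpleModule Λ T)
      {s : Multiset (SimpleModuleClasses Λ)} :
      HasFactors (LinearMap.ker g) s → HasFactors M (simpleClass T hT ::ₘ s)

namespace HasFactors

variable {M : Type u} [AddCommGroup M] [Module Λ M] {s t : Multiset (SimpleModuleClasses Λ)}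

lemma congr (h : HasFactors Λ M s) {M' : Type u} [AddCommGroup M'] [Module Λ M']
    (e : M ≃ₗ[Λ] M') : HasFactors Λ M' s := by
  induction h generalizing M' with
  | zero =>
    have := e.symm.toEquiv.subsingleton
    exact .zero
  | @cons M T _ _ _ _ g hg hT s h ih =>
    refine .cons (g ∘ₗ e.symm.toLinearMap) (hg.comp e.symm.surjective) hT (ih ?_)
    refine (e.submoduleMap (LinearMap.ker g)).trans (LinearEquiv.ofEq _ _ ?_)
    rw [LinearMap.ker_comp]
    exact Submodule.map_equiv_eq_comap_symm e _

lemma isFiniteLength (h : HasFactors Λ M s) : IsFiniteLength Λ M := by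
  induction h with
  | zero => exact .of_subsingleton
  | @cons M T _ _ _ _ g hg hT s h ih =>
    have := IsSimpleModule.congr (g.quotKerEquivOfSurjective hg)
    exact .of_simple_quotient ih

lemma exists_of_isFiniteLength (h : IsFiniteLength Λ M) : ∃ s, HasFactors Λ M s := by
  induction h with
  | of_subsingleton => exact ⟨0, .zero⟩
  | @of_simple_quotient M _ _ N hN _ ih =>
    obtain ⟨s, hs⟩ := ih
    exact ⟨_, .cons N.mkQ N.mkQ_surjective hN (hs.congr (LinearEquiv.ofEq _ _ N.ker_mkQ.symm))⟩

/-- A composition series of a submodule and one of the quotient combine to a composition series. -/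
lemma of_exact {A B C : Type u} [AddCommGroup A] [Module Λ A] [AddCommGroup B] [Module Λ B]
    [AddCommGroup C] [Module Λ C] (hC : HasFactors Λ C s) (hA : HasFactors Λ A t)
    (f : A →ₗ[Λ] B) (g : B →ₗ[Λ] C) (hf : Function.Injective f) (hfg : Function.Exact f g)
    (hg : Function.Surjective g) : HasFactors Λ B (s + t) := by
  induction hC generalizing B with
  | zero =>
    rw [zero_add]
    exact hA.congr (LinearEquiv.ofBijective f
      ⟨hf, fun b => (hfg b).1 (Subsingleton.elim _ _)⟩)
  | @cons C T _ _ _ _ q hq hT s h ih =>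
    rw [Multiset.cons_add]
    refine .cons (q ∘ₗ g) (hq.comp hg) hT (ih
      (f.codRestrict _ fun a => by simp [hfg.apply_apply_eq_zero])
      ((g ∘ₗ (LinearMap.ker (q ∘ₗ g)).subtype).codRestrict _ fun b => b.2) ?_ ?_ ?_)
    · intro a a' h
      exact hf (congrArg Subtype.val h)
    · rintro ⟨b, hb⟩
      refine ⟨fun h => ?_, ?_⟩
      · obtain ⟨a, rfl⟩ := (hfg b).1 (congrArg Subtype.val h)
        exact ⟨a, rfl⟩
      · rintro ⟨a, ha⟩
        obtain rfl := congrArg Subtype.val ha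
        exact Subtype.ext (hfg.apply_apply_eq_zero a)
    · rintro ⟨c, hc⟩
      obtain ⟨b, rfl⟩ := hg c
      exact ⟨⟨b, hc⟩, rfl⟩

/-- If two simple quotients of `M` have different kernels, then the intersection of the kernels is
the kernel of a simple quotient of either kernel. -/
lemma ker_of_inf {T₁ T₂ : Type u} [AddCommGroup T₁] [Module Λ T₁] [AddCommGroup T₂]
    [Module Λ T₂] (g₁ : M →ₗ[Λ] T₁) (g₂ : M →ₗ[Λ] T₂) (hT₂ : IsSimpleModule Λ T₂)
    (hle : ¬ LinearMap.ker g₁ ≤ LinearMap.ker g₂)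
    (h : HasFactors Λ (LinearMap.ker g₁ ⊓ LinearMap.ker g₂ : Submodule Λ M) s) :
    HasFactors Λ (LinearMap.ker g₁) (simpleClass T₂ hT₂ ::ₘ s) := by
  refine .cons (g₂ ∘ₗ (LinearMap.ker g₁).subtype) ?_ hT₂ (h.congr ?_)
  · refine (LinearMap.surjective_or_eq_zero _).resolve_right fun h0 => hle fun x hx => ?_
    exact LinearMap.congr_fun h0 ⟨x, hx⟩
  · refine (Submodule.equivMapOfInjective _ (LinearMap.ker g₁).injective_subtype _ |>.trans
      (LinearEquiv.ofEq _ _ ?_)).symm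
    rw [LinearMap.ker_comp, Submodule.map_comap_subtype]

/-- The Jordan–Hölder theorem: the multiset of composition factors is unique. -/
theorem unique (hs : HasFactors Λ M s) (ht : HasFactors Λ M t) : s = t := by
  induction hn : Multiset.card s generalizing M s t with
  | zero =>
    cases hs with
    | cons g hg hT h => simp at hn
    | zero =>
      cases ht with
      | zero => rfl
      | cons g hg hT h =>
        have := hT.nontrivial
        exact absurd hg.subsingleton (not_subsingleton _)
  | succ n ih =>
    cases hs with
    | zero => simp at hn
    | @cons _ T₁ _ _ _ _ g₁ hg₁ hT₁ s₁ h₁ =>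
    cases ht with
    | zero =>
      have := hT₁.nontrivial
      exact absurd hg₁.subsingleton (not_subsingleton _)
    | @cons _ T₂ _ _ _ _ g₂ hg₂ hT₂ s₂ h₂ =>
    have hn₁ : Multiset.card s₁ = n := by simpa using hn
    have m₁ : IsCoatom (LinearMap.ker g₁) := by
      rw [← isSimpleModule_iff_isCoatom]
      exact IsSimpleModule.congr (g₁.quotKerEquivOfSurjective hg₁)
    have m₂ : IsCoatom (LinearMap.ker g₂) := by
      rw [← isSimpleModule_iff_isCoatom]
      exact IsSimpleModule.congr (g₂.quotKerEquivOfSurjective hg₂)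
    -- If the kernels of the two top quotients differ, both series are compared with series that pass
    -- through the intersection of the kernels.
    by_cases hker : LinearMap.ker g₁ = LinearMap.ker g₂
    · have e : T₁ ≃ₗ[Λ] T₂ := (g₁.quotKerEquivOfSurjective hg₁).symm.trans
        ((Submodule.quotEquivOfEq _ _ hker).trans (g₂.quotKerEquivOfSurjective hg₂))
      rw [simpleClass_eq hT₁ hT₂ e, ih (h₁.congr (LinearEquiv.ofEq _ _ hker)) h₂ hn₁]
    · obtain ⟨k, hk⟩ := exists_of_isFiniteLength (h₁.isFiniteLength.of_injective
        (Submodule.inclusion_injective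
          (inf_le_left : LinearMap.ker g₁ ⊓ LinearMap.ker g₂ ≤ _)))
      have e₁ := ih h₁ (hk.ker_of_inf g₁ g₂ hT₂
        fun hle => hker ((m₁.le_iff_eq m₂.1).1 hle).symm) hn₁
      have hk' : HasFactors Λ (LinearMap.ker g₂ ⊓ LinearMap.ker g₁ : Submodule Λ M) k :=
        hk.congr (LinearEquiv.ofEq _ _ (inf_comm _ _))
      have e₂ := ih (hk'.ker_of_inf g₂ g₁ hT₁
        fun hle => hker ((m₂.le_iff_eq m₁.1).1 hle)) h₂ (by
          rw [← hn₁, e₁]; simp)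
      rw [e₁, ← e₂, Multiset.cons_swap]

end HasFactors

open Classical in
variable (Λ) in
/-- The multiset of isomorphism classes of the composition factors of a module of finite length;
it is empty by convention if the module does not have finite length. -/
noncomputable def compositionFactors (M : Type u) [AddCommGroup M] [Module Λ M] :
    Multiset (SimpleModuleClasses Λ) :=
  if h : ∃ s, HasFactors Λ M s then h.choose else 0

lemma hasFactors_compositionFactors {M : Type u} [AddCommGroup M] [Module Λ M]
    (h : IsFiniteLength Λ M) : HasFactors Λ M (compositionFactors Λ M) := by
  have h := HasFactors.exists_of_isFiniteLength h
  rw [compositionFactors, dif_pos h]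
  exact h.choose_spec

lemma compositionFactors_of_exact {A B C : Type u} [AddCommGroup A] [Module Λ A]
    [AddCommGroup B] [Module Λ B] [AddCommGroup C] [Module Λ C] (hB : IsFiniteLength Λ B)
    (f : A →ₗ[Λ] B) (g : B →ₗ[Λ] C) (hf : Function.Injective f) (hfg : Function.Exact f g)
    (hg : Function.Surjective g) :
    compositionFactors Λ B = compositionFactors Λ A + compositionFactors Λ C := by
  rw [add_comm]
  exact (hasFactors_compositionFactors hB).unique
    ((hasFactors_compositionFactors (hB.of_surjective hg)).of_exact
      (hasFactors_compositionFactors (hB.of_injective hf)) f g hf hfg hg)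

lemma hasFactors_simple {T : Type u} [AddCommGroup T] [Module Λ T] (hT : IsSimpleModule Λ T) :
    HasFactors Λ T {simpleClass T hT} := by
  have : Subsingleton (LinearMap.ker (LinearMap.id : T →ₗ[Λ] T)) := by
    rw [LinearMap.ker_id]
    infer_instance
  exact .cons LinearMap.id Function.surjective_id hT .zero

lemma compositionFactors_simple {T : Type u} [AddCommGroup T] [Module Λ T]
    (hT : IsSimpleModule Λ T) : compositionFactors Λ T = {simpleClass T hT} :=
  (hasFactors_compositionFactors (hasFactors_simple hT).isFiniteLength).unique
    (hasFactors_simple hT)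

variable (Λ) in
/-- An Artinian ring has only finitely many simple modules, as each of them is a composition
factor of the ring itself. -/
lemma finite_simpleModuleClasses [IsArtinianRing Λ] [IsNoetherianRing Λ] :
    Finite (SimpleModuleClasses Λ) := by
  have hΛ : IsFiniteLength Λ Λ := isFiniteLength_iff_isNoetherian_isArtinian.2 ⟨‹_›, ‹_›⟩
  refine Set.finite_univ_iff.1 ((compositionFactors Λ Λ).finite_toSet.subset ?_)
  rintro ⟨M, hM⟩ -
  have := IsSimpleModule.nontrivial Λ M
  obtain ⟨x, hx⟩ := exists_ne (0 : M)
  have hs := IsSimpleModule.toSpanSingleton_surjective Λ hx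
  have := compositionFactors_of_exact hΛ _ _ (Submodule.injective_subtype _)
    (LinearMap.exact_subtype_ker_map (LinearMap.toSpanSingleton Λ M x)) hs
  change _ ∈ compositionFactors Λ Λ
  rw [this, compositionFactors_simple hM]
  exact Multiset.mem_add.2 (Or.inr (Multiset.mem_singleton.2 rfl))

end CompositionFactors

/-! ### Cones and short exact sequences of complexes -/

section ConeOfMono

open homotopyCofiber

variable {A : Type u} [Category.{v} A] [Abelian A] {ι : Type*} {c : ComplexShape ι}

lemma shortExact_zero_of_isZero {X : A} (hX : IsZero X) :
    (ShortComplex.mk (0 : X ⟶ X) (0 : X ⟶ X) comp_zero).ShortExact where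
  exact := ShortComplex.exact_of_isZero_X₂ _ hX
  mono_f := ⟨fun _ _ _ => hX.eq_of_tgt _ _⟩
  epi_g := ⟨fun _ _ _ => hX.eq_of_src _ _⟩

lemma shortExact_of_exists_lift {X Y Z : A} (f : X ⟶ Y) (g : Y ⟶ Z) (w : f ≫ g = 0)
    (hf : Mono f) (hg : Epi g) (h : ∀ (P : A) (a : P ⟶ Y), a ≫ g = 0 → ∃ b, b ≫ f = a) :
    (ShortComplex.mk f g w).ShortExact :=
  ShortComplex.ShortExact.mk' (ShortComplex.exact_of_f_is_kernel _
    (KernelFork.IsLimit.ofι' _ _ fun {P} a ha => ⟨(h P a ha).choose, (h P a ha).choose_spec⟩)) hf hg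

/-- In a short exact sequence of complexes with acyclic kernel, the epimorphism is a
quasi-isomorphism. -/
lemma quasiIso_g_of_acyclic {S : ShortComplex (HomologicalComplex A c)} (hS : S.ShortExact)
    (h : S.X₁.Acyclic) (hnext : ∀ i, c.Rel i (c.next i)) : QuasiIso S.g := by
  have h0 (i) : IsZero (S.X₁.homology i) := (S.X₁.exactAt_iff_isZero_homology i).1 (h i)
  rw [quasiIso_iff]
  intro i
  rw [quasiIsoAt_iff_isIso_homologyMap]
  have : Mono (homologyMap S.g i) :=
    (hS.homology_exact₂ i).mono_g ((h0 i).eq_of_src _ _)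
  have : Epi (homologyMap S.g i) :=
    (hS.homology_exact₃ i _ (hnext i)).epi_f ((h0 _).eq_of_tgt _ _)
  exact isIso_of_mono_of_epi _

variable [DecidableRel c.Rel]

/-- The cone of an identity is contractible: the contracting homotopy sends the copy of `K^i` in
`K^{i+1} ⊕ K^i` to the copy of `K^i` in `K^i ⊕ K^{i-1}`. -/
noncomputable def homotopyCofiberIdContraction (K : HomologicalComplex A c)
    (hnext : ∀ i, c.Rel i (c.next i)) (hprev : ∀ j, ∃ i, c.Rel i j) :
    Homotopy (𝟙 (homotopyCofiber (𝟙 K))) 0 where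
  hom i j := if h : c.Rel j i then sndX (𝟙 K) i ≫ inlX (𝟙 K) i j h else 0
  zero i j h := dif_neg h
  comm j := by
    obtain ⟨i, hij⟩ := hprev j
    have hjk := hnext j
    rw [dNext_eq _ hjk, prevD_eq _ hij, dif_pos hij, dif_pos hjk]
    refine ext_from_X (𝟙 K) _ j hjk ?_ ?_
    · simp [inlX_d_assoc _ _ _ _ hjk (hnext _)]
    · simp [inlX_d _ _ _ _ hij hjk]

lemma acyclic_homotopyCofiber_id (K : HomologicalComplex A c)
    (hnext : ∀ i, c.Rel i (c.next i)) (hprev : ∀ j, ∃ i, c.Rel i j) :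
    (homotopyCofiber (𝟙 K)).Acyclic := by
  intro i
  rw [exactAt_iff_isZero_homology, IsZero.iff_id_eq_zero, ← homologyMap_id,
    (homotopyCofiberIdContraction K hnext hprev).homologyMap_eq i, homologyMap_zero]

variable (S : ShortComplex (HomologicalComplex A c))

/-- For a complex `K ⟶ L ⟶ M`, the map `Cone (K ⟶ L) ⟶ M` which is zero on `K^{i+1}`. -/
noncomputable def coneDesc : homotopyCofiber S.f ⟶ S.X₃ :=
  desc S.f S.g (Homotopy.ofEq S.zero)

lemma coneDesc_f (hnext : ∀ i, c.Rel i (c.next i)) (i : ι) :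
    (coneDesc S).f i = sndX S.f i ≫ S.g.f i := by
  rw [coneDesc, desc_f _ _ _ _ _ (hnext i)]
  simp [Homotopy.ofEq]

/-- The map `Cone (𝟙 K) ⟶ Cone f` induced by `f : K ⟶ L`. -/
noncomputable def coneIdTo {K L : HomologicalComplex A c} (f : K ⟶ L)
    (hprev : ∀ j, ∃ i, c.Rel i j) :
    homotopyCofiber (𝟙 K) ⟶ homotopyCofiber f :=
  desc (𝟙 K) (f ≫ inr f)
    ((Homotopy.ofEq (Category.id_comp _)).trans (inrCompHomotopy f hprev))

lemma coneIdTo_f {K L : HomologicalComplex A c} (f : K ⟶ L)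
    (hprev : ∀ j, ∃ i, c.Rel i j) (i j : ι) (hij : c.Rel i j) :
    (coneIdTo f hprev).f i = fstX (𝟙 K) i j hij ≫ inlX f j i hij +
      sndX (𝟙 K) i ≫ f.f i ≫ inrX f i := by
  rw [coneIdTo, desc_f _ _ _ _ _ hij]
  simp [Homotopy.ofEq, inrCompHomotopy_hom _ _ _ _ hij]

/-- The sequence `0 ⟶ Cone (𝟙 K) ⟶ Cone (K ⟶ L) ⟶ M ⟶ 0` attached to a short complex
`K ⟶ L ⟶ M`. -/
noncomputable def coneShortComplex (hnext : ∀ i, c.Rel i (c.next i))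
    (hprev : ∀ j, ∃ i, c.Rel i j) : ShortComplex (HomologicalComplex A c) :=
  ShortComplex.mk (coneIdTo S.f hprev) (coneDesc S) (by
    ext i
    have h : S.f.f i ≫ S.g.f i = 0 := by rw [← comp_f, S.zero, zero_f]
    simp [coneDesc_f S hnext, coneIdTo_f S.f hprev _ _ (hnext i), h])

lemma coneShortComplex_shortExact (hS : S.ShortExact) (hnext : ∀ i, c.Rel i (c.next i))
    (hprev : ∀ j, ∃ i, c.Rel i j) : (coneShortComplex S hnext hprev).ShortExact := by
  refine shortExact_of_degreewise_shortExact _ fun i => ?_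
  have w : S.f.f i ≫ S.g.f i = 0 := by rw [← comp_f, S.zero, zero_f]
  have hSi : (ShortComplex.mk (S.f.f i) (S.g.f i) w).ShortExact :=
    (shortExact_iff_degreewise_shortExact S).1 hS i
  have hm : Mono (S.f.f i) := hSi.mono_f
  have he : Epi (S.g.f i) := hSi.epi_g
  have hf := coneIdTo_f S.f hprev i _ (hnext i)
  have hg := coneDesc_f S hnext i
  refine shortExact_of_exists_lift ((coneIdTo S.f hprev).f i) ((coneDesc S).f i) _ ?_ ?_ ?_
  · rw [Preadditive.mono_iff_cancel_zero]
    intro P a ha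
    rw [hf] at ha
    refine ext_to_X (𝟙 S.X₁) i _ (hnext i) ?_ ?_
    · simpa using ha =≫ fstX S.f i _ (hnext i)
    · rw [← cancel_mono (S.f.f i)]
      simpa using ha =≫ sndX S.f i
  · rw [hg]
    have : Epi (sndX S.f i) := epi_of_epi_fac (inrX_sndX S.f i)
    exact epi_comp _ _
  · intro P a ha
    rw [hg, ← Category.assoc] at ha
    have hl : hSi.exact.lift _ ha ≫ S.f.f i = _ := hSi.exact.lift_f _ ha
    refine ⟨a ≫ fstX S.f i _ (hnext i) ≫ inlX (𝟙 S.X₁) _ i (hnext i) +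
      hSi.exact.lift _ ha ≫ inrX (𝟙 S.X₁) i, ?_⟩
    rw [hf]
    refine ext_to_X S.f i _ (hnext i) ?_ ?_
    · simp
    · simp [hl]

/-- If `0 ⟶ K ⟶ L ⟶ M ⟶ 0` is a short exact sequence of complexes, then `Cone (K ⟶ L) ⟶ M` is a
quasi-isomorphism: its kernel is the contractible complex `Cone (𝟙 K)`. -/
lemma quasiIso_coneDesc (hS : S.ShortExact) (hnext : ∀ i, c.Rel i (c.next i))
    (hprev : ∀ j, ∃ i, c.Rel i j) : QuasiIso (coneDesc S) :=
  quasiIso_g_of_acyclic (coneShortComplex_shortExact S hS hnext hprev)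
    (acyclic_homotopyCofiber_id S.X₁ hnext hprev) hnext

end ConeOfMono

/-! ### Euler characteristics of periodic complexes -/

section EulerCharacteristic

variable {A : Type u} [Category.{v} A] [Abelian A] {G : Type*} [AddCommGroup G]

/-- A function on the objects of an abelian category is additive if it is additive on short exact
sequences. -/
def IsAdditiveOnShortExact (μ : A → G) : Prop :=
  ∀ S : ShortComplex A, S.ShortExact → μ S.X₂ = μ S.X₁ + μ S.X₃

namespace IsAdditiveOnShortExact

variable {μ : A → G} (hμ : IsAdditiveOnShortExact μ)

include hμ

lemma map_isZero {X : A} (hX : IsZero X) : μ X = 0 := by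
  simpa using hμ _ (shortExact_zero_of_isZero hX)

open scoped ZeroObject in
lemma map_iso {X Y : A} (e : X ≅ Y) : μ X = μ Y := by
  have h : (ShortComplex.mk e.hom (0 : Y ⟶ 0) (by simp)).ShortExact :=
    { exact := (ShortComplex.exact_iff_epi _ rfl).2 (inferInstanceAs (Epi e.hom))
      mono_f := inferInstanceAs (Mono e.hom)
      epi_g := ⟨fun _ _ _ => (isZero_zero A).eq_of_src _ _⟩ }
  have := hμ _ h
  dsimp at this
  rw [hμ.map_isZero (isZero_zero A), add_zero] at this
  exact this.symm

lemma map_biprod (X Y : A) : μ (X ⊞ Y) = μ X + μ Y :=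
  hμ _ (ShortComplex.Splitting.ofHasBinaryBiproduct X Y).shortExact

/-- The image of `f` is both `X / ker f` and the kernel of `Y ⟶ coker f`. -/
lemma map_add_map_cokernel {X Y : A} (f : X ⟶ Y) :
    μ X + μ (cokernel f) = μ Y + μ (kernel f) := by
  have h₁ := hμ _ (shortExact_of_exists_lift (kernel.ι f) (Abelian.factorThruImage f)
    (by rw [← cancel_mono (Abelian.image.ι f)]; simp) inferInstance inferInstance
    fun P a ha => ⟨kernel.lift f a (by
      rw [← Abelian.image.fac f, reassoc_of% ha, zero_comp]), by simp⟩)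
  have h₂ := hμ _ (shortExact_of_exists_lift (Abelian.image.ι f) (cokernel.π f)
    (kernel.condition _) inferInstance inferInstance
    fun P a ha => ⟨kernel.lift _ a ha, by simp⟩)
  dsimp at h₁ h₂
  rw [h₁, h₂]
  abel

/-- With `r (f) = μ (X) - μ (ker f)` for `f : X ⟶ Y`, this is `μ (K^j) = μ (H^j) + r (d') + r (d)`,
where `d'` and `d` are the differentials into and out of `K^j`. -/
lemma map_X_eq {ι : Type*} {c : ComplexShape ι} (K : HomologicalComplex A c) (i j k : ι)
    (hij : c.prev j = i) (hjk : c.next j = k) :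
    μ (K.X j) = μ (K.homology j) + (μ (K.X i) - μ (kernel (K.d i j))) +
      (μ (K.X j) - μ (kernel (K.d j k))) := by
  have h₁ := hμ.map_add_map_cokernel (K.toCycles i j)
  have e₁ : μ (cokernel (K.toCycles i j)) = μ (K.homology j) :=
    hμ.map_iso ((colimit.isColimit _).coconePointUniqueUpToIso (K.homologyIsCokernel i j hij))
  have e₂ : μ (K.cycles j) = μ (kernel (K.d j k)) :=
    hμ.map_iso ((K.cyclesIsKernel j k hjk).conePointUniqueUpToIso (limit.isLimit _))
  have e₃ : μ (kernel (K.toCycles i j)) = μ (kernel (K.d i j)) :=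
    hμ.map_iso ((kernelCompMono (K.toCycles i j) (K.iCycles j)).symm ≪≫
      kernelIsoOfEq (K.toCycles_i i j))
  rw [e₁, e₂, e₃] at h₁
  rw [← eq_sub_iff_add_eq'] at h₁
  rw [h₁]
  abel

end IsAdditiveOnShortExact

variable (m : ℕ)

/-- For `ε` with `ε (i + 1) = - ε (i)`, the Euler characteristic of a periodic complex agrees with
that of its cohomology, since the contributions of the images of the differentials cancel. -/
lemma sum_homology_eq_sum_X {k : Type*} [Ring k] [Module k G] [NeZero m] {μ : A → G}
    (hμ : IsAdditiveOnShortExact μ) (ε : ZMod m → k) (hε : ∀ i, ε (i + 1) = - ε i)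
    (K : PeriodicComplex A m) :
    ∑ i, ε i • μ (K.homology i) = ∑ i, ε i • μ (K.X i) := by
  set r : ZMod m → G := fun i => μ (K.X i) - μ (kernel (K.d i (i + 1))) with hr
  have hr' (i j : ZMod m) (h : i + 1 = j) : μ (K.X i) - μ (kernel (K.d i j)) = r i := by
    subst h
    rfl
  have key (i : ZMod m) : ε i • μ (K.X i) =
      ε i • μ (K.homology i) + (ε i • r (i - 1) + ε i • r i) := by
    rw [← smul_add, ← smul_add, hμ.map_X_eq K (i - 1) i (i + 1)
      (ComplexShape.prev_eq' _ (sub_add_cancel i 1)) (ComplexShape.next_eq' _ rfl),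
      hr' _ _ (sub_add_cancel i 1), hr' _ _ rfl, add_assoc]
  rw [Finset.sum_congr rfl fun i _ => key i, Finset.sum_add_distrib, Finset.sum_add_distrib,
    left_eq_add, ← Equiv.sum_comp (Equiv.addRight (1 : ZMod m)), ← Finset.sum_add_distrib]
  exact Finset.sum_eq_zero fun i _ => by simp [hε]

/-- The Euler characteristic of a cone `(Kⁱ⁺¹ ⊕ Lⁱ)ᵢ`: reindexing the first summand produces the
sign. -/
lemma sum_X_homotopyCofiber {k : Type*} [Ring k] [Module k G] [NeZero m] {μ : A → G}
    (hμ : IsAdditiveOnShortExact μ) (ε : ZMod m → k) (hε : ∀ i, ε (i + 1) = - ε i)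
    {K L : PeriodicComplex A m} (f : K ⟶ L) :
    ∑ i, ε i • μ ((homotopyCofiber f).X i) = ∑ i, ε i • μ (L.X i) - ∑ i, ε i • μ (K.X i) := by
  have key (i : ZMod m) : ε i • μ ((homotopyCofiber f).X i) =
      ε i • μ (L.X i) - ε (i + 1) • μ (K.X (i + 1)) := by
    have h : μ ((homotopyCofiber f).X i) = μ (K.X (i + 1)) + μ (L.X i) :=
      (hμ.map_iso (homotopyCofiber.XIsoBiprod f i (i + 1) rfl)).trans (hμ.map_biprod _ _)
    rw [hε, h, smul_add, neg_smul, sub_neg_eq_add, add_comm]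
  rw [Finset.sum_congr rfl fun i _ => key i, Finset.sum_sub_distrib,
    ← Equiv.sum_comp (Equiv.addRight (1 : ZMod m)) fun i => ε i • μ (K.X i)]
  rfl

/-- Cohomology in degree `i` as a functor on the periodic derived category. -/
noncomputable def PeriodicDerivedCategory.homologyFunctor (A : Type u) [Category.{v} A] [Abelian A]
    (m : ℕ) (i : ZMod m) : PeriodicDerivedCategory A m ⥤ A :=
  Localization.lift (HomotopyCategory.homologyFunctor A (ComplexShape.up (ZMod m)) i)
    (HomotopyCategory.homologyFunctor_inverts_quasiIso A _ i)
    (HomotopyCategory.quasiIso A (ComplexShape.up (ZMod m))).Q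

/-- A periodic complex as an object of the periodic derived category. -/
noncomputable abbrev PeriodicComplex.toDerived {A : Type u} [Category.{v} A] [Abelian A]
    {m : ℕ} (K : PeriodicComplex A m) : PeriodicDerivedCategory A m :=
  (HomotopyCategory.quasiIso A (ComplexShape.up (ZMod m))).Q.obj
    ((HomotopyCategory.quotient A (ComplexShape.up (ZMod m))).obj K)

/-- On a periodic complex, the functor `homologyFunctor` is the usual cohomology. -/
noncomputable def PeriodicDerivedCategory.homologyFunctorObjIso (K : PeriodicComplex A m)
    (i : ZMod m) : (homologyFunctor A m i).obj K.toDerived ≅ K.homology i :=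
  (Localization.fac _ (HomotopyCategory.homologyFunctor_inverts_quasiIso A _ i) _).app _ ≪≫
    (HomotopyCategory.homologyFunctorFactors A _ i).app K

end EulerCharacteristic

/-! ### The Grothendieck group of the periodic derived category -/

section GrothendieckGroupOfPeriodicDerivedCategory

variable {A : Type u} [Category.{v} A] [Abelian A] {m : ℕ}

open PeriodicDerivedCategory

section LowerBound

variable {G k : Type*} [AddCommGroup G] [Ring k] [Module k G] [NeZero m] {μ : A → G}

/-- The alternating sum `∑ ε i • μ (Hⁱ X)` as a function on isomorphism classes of objects of the
periodic derived category. -/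
noncomputable def eulerCharacteristicOfIsoClass (hμ : IsAdditiveOnShortExact μ) (ε : ZMod m → k) :
    Quotient (isIsomorphicSetoid (PeriodicDerivedCategory A m)) → G :=
  Quotient.lift (fun X => ∑ i, ε i • μ ((PeriodicDerivedCategory.homologyFunctor A m i).obj X))
    fun _ _ ⟨e⟩ => Finset.sum_congr rfl fun i _ => by
      rw [hμ.map_iso ((PeriodicDerivedCategory.homologyFunctor A m i).mapIso e)]

lemma eulerCharacteristicOfIsoClass_eq (hμ : IsAdditiveOnShortExact μ) (ε : ZMod m → k)
    (hε : ∀ i, ε (i + 1) = - ε i) (K : PeriodicComplex A m) {X : PeriodicDerivedCategory A m}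
    (e : X ≅ K.toDerived) :
    eulerCharacteristicOfIsoClass hμ ε (Quotient.mk _ X) = ∑ i, ε i • μ (K.X i) := by
  rw [← sum_homology_eq_sum_X m hμ ε hε]
  exact Finset.sum_congr rfl fun i _ => by
    rw [hμ.map_iso ((PeriodicDerivedCategory.homologyFunctor A m i).mapIso e ≪≫
      homologyFunctorObjIso m K i)]

/-- The Euler characteristic attached to an additive function `μ` and signs `ε`, as a homomorphism
on the Grothendieck group of the periodic derived category. -/
noncomputable def eulerCharacteristic (hμ : IsAdditiveOnShortExact μ) (ε : ZMod m → k)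
    (hε : ∀ i, ε (i + 1) = - ε i) : TriangulatedK0 (exactTriangles A m) →+ G :=
  QuotientAddGroup.lift _ (FreeAbelianGroup.lift (eulerCharacteristicOfIsoClass hμ ε)) <| by
    rw [triangleRelations, AddSubgroup.closure_le]
    rintro _ ⟨T, ⟨T', ⟨V, W, f, ⟨e'⟩⟩, ⟨e⟩⟩, rfl⟩
    let e'' := e ≪≫ (HomotopyCategory.quasiIso A (ComplexShape.up (ZMod m))).Q.mapTriangle.mapIso e'
    have e₁ : T.obj₁ ≅ V.toDerived := Pretriangulated.Triangle.π₁.mapIso e''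
    have e₂ : T.obj₂ ≅ W.toDerived := Pretriangulated.Triangle.π₂.mapIso e''
    have e₃ : T.obj₃ ≅ PeriodicComplex.toDerived (homotopyCofiber f) :=
      Pretriangulated.Triangle.π₃.mapIso e''
    rw [SetLike.mem_coe, AddMonoidHom.mem_ker, map_add, map_sub]
    simp only [freeIsoClass, FreeAbelianGroup.lift_apply_of]
    rw [eulerCharacteristicOfIsoClass_eq hμ ε hε _ e₁,
      eulerCharacteristicOfIsoClass_eq hμ ε hε _ e₂,
      eulerCharacteristicOfIsoClass_eq hμ ε hε _ e₃, sum_X_homotopyCofiber m hμ ε hε]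
    abel

end LowerBound

/-- The class in the Grothendieck group of an object of the periodic derived category. -/
noncomputable def derivedClass (X : PeriodicDerivedCategory A m) :
    TriangulatedK0 (exactTriangles A m) :=
  QuotientAddGroup.mk (freeIsoClass X)

lemma derivedClass_eq_of_iso {X Y : PeriodicDerivedCategory A m} (e : X ≅ Y) :
    derivedClass X = derivedClass Y := by
  have h : Quotient.mk (isIsomorphicSetoid (PeriodicDerivedCategory A m)) X = Quotient.mk _ Y :=
    Quotient.sound ⟨e⟩
  rw [derivedClass, derivedClass, freeIsoClass, freeIsoClass, h]

namespace PeriodicComplex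

/-- The class in the Grothendieck group of a periodic complex. -/
noncomputable def k0Class (K : PeriodicComplex A m) : TriangulatedK0 (exactTriangles A m) :=
  derivedClass K.toDerived

lemma eulerCharacteristic_k0Class {G k : Type*} [AddCommGroup G] [Ring k] [Module k G] [NeZero m]
    {μ : A → G} (hμ : IsAdditiveOnShortExact μ) (ε : ZMod m → k) (hε : ∀ i, ε (i + 1) = - ε i)
    (K : PeriodicComplex A m) :
    eulerCharacteristic hμ ε hε K.k0Class = ∑ i, ε i • μ (K.X i) := by
  rw [← eulerCharacteristicOfIsoClass_eq hμ ε hε K (Iso.refl _), k0Class, derivedClass,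
    eulerCharacteristic]
  erw [QuotientAddGroup.lift_mk, FreeAbelianGroup.lift_apply_of]

lemma k0Class_eq_of_iso {K L : PeriodicComplex A m} (e : K ≅ L) : K.k0Class = L.k0Class :=
  derivedClass_eq_of_iso ((HomotopyCategory.quasiIso A _).Q.mapIso
    ((HomotopyCategory.quotient A _).mapIso e))

lemma k0Class_eq_of_quasiIso {K L : PeriodicComplex A m} (f : K ⟶ L) [QuasiIso f] :
    K.k0Class = L.k0Class := by
  have := Localization.inverts (HomotopyCategory.quasiIso A (ComplexShape.up (ZMod m))).Q
    (HomotopyCategory.quasiIso A _) ((HomotopyCategory.quotient A _).map f) (by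
      rwa [HomotopyCategory.quotient_map_mem_quasiIso_iff, mem_quasiIso_iff])
  exact derivedClass_eq_of_iso (asIso
    ((HomotopyCategory.quasiIso A (ComplexShape.up (ZMod m))).Q.map
      ((HomotopyCategory.quotient A _).map f)))

lemma k0Class_homotopyCofiber {K L : PeriodicComplex A m} (f : K ⟶ L) :
    k0Class (homotopyCofiber f) = L.k0Class - K.k0Class := by
  have h : QuotientAddGroup.mk (s := triangleRelations (exactTriangles A m))
      (freeIsoClass K.toDerived - freeIsoClass L.toDerived +
        freeIsoClass (PeriodicComplex.toDerived (homotopyCofiber f))) = 0 := by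
    rw [QuotientAddGroup.eq_zero_iff]
    exact AddSubgroup.subset_closure
      ⟨_, ⟨_, ⟨K, L, f, ⟨Iso.refl _⟩⟩, ⟨Iso.refl _⟩⟩, rfl⟩
  have h' : K.k0Class - L.k0Class + k0Class (homotopyCofiber f) = 0 := h
  rw [eq_neg_of_add_eq_zero_right h']
  abel

/-- Short exact sequences of complexes give relations in the Grothendieck group, because the cokernel
is quasi-isomorphic to the cone. -/
lemma k0Class_of_shortExact {S : ShortComplex (PeriodicComplex A m)} (hS : S.ShortExact) :
    S.X₂.k0Class = S.X₁.k0Class + S.X₃.k0Class := by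
  have hnext (i : ZMod m) : (ComplexShape.up (ZMod m)).Rel i ((ComplexShape.up (ZMod m)).next i) :=
    (ComplexShape.next_eq' (ComplexShape.up (ZMod m)) (rfl : i + 1 = i + 1)).symm
  have := quasiIso_coneDesc S hS hnext fun j => ⟨j - 1, sub_add_cancel j 1⟩
  rw [← k0Class_eq_of_quasiIso (coneDesc S), k0Class_homotopyCofiber]
  abel

lemma isZero_of_isZero_X (K : PeriodicComplex A m) (h : ∀ i, IsZero (K.X i)) : IsZero K := by
  rw [IsZero.iff_id_eq_zero]
  ext i
  exact (h i).eq_of_src _ _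

lemma k0Class_of_isZero {K : PeriodicComplex A m} (h : IsZero K) : K.k0Class = 0 := by
  simpa using k0Class_of_shortExact (shortExact_zero_of_isZero h)

/-- If `K` and `L` have zero differentials and `Lⁱ ≅ Kⁱ⁺¹`, then `L ≅ K[1]`, which is the cone of
`K ⟶ 0`. -/
lemma k0Class_eq_neg_of_iso {K L : PeriodicComplex A m} (hK : ∀ i j, K.d i j = 0)
    (hL : ∀ i j, L.d i j = 0) (e : ∀ i, L.X i ≅ K.X (i + 1)) : L.k0Class = - K.k0Class := by
  obtain ⟨Z, hZ⟩ : ∃ Z : PeriodicComplex A m, IsZero Z := ⟨_, isZero_zero _⟩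
  have hZX (i) : IsZero (Z.X i) := (eval A (ComplexShape.up (ZMod m)) i).map_isZero hZ
  have he : (homotopyCofiber (0 : K ⟶ Z)) ≅ L := by
    refine Hom.isoOfComponents (fun i => homotopyCofiber.XIsoBiprod (0 : K ⟶ Z) i (i + 1) rfl ≪≫
      ⟨biprod.fst, biprod.inl, ?_, ?_⟩ ≪≫ (e i).symm) fun i j hij => ?_
    · ext
      · simp
      · exact (hZX i).eq_of_tgt _ _
      · simp
      · exact (hZX i).eq_of_tgt _ _
    · simp
    · obtain rfl : i + 1 = j := hij
      have hd : homotopyCofiber.d (0 : K ⟶ Z) i (i + 1) = 0 := by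
        refine homotopyCofiber.ext_from_X _ (i + 1) i rfl ?_ ((hZX i).eq_of_src _ _)
        rw [homotopyCofiber.inlX_d _ i (i + 1) (i + 1 + 1) rfl rfl, hK]
        simp
      rw [hL, comp_zero, homotopyCofiber_d, hd, zero_comp]
  rw [← k0Class_eq_of_iso he, k0Class_homotopyCofiber, k0Class_of_isZero hZ, zero_sub]

lemma k0Class_single (X : A) (i j : ZMod m) (h : i + 1 = j) :
    k0Class ((single A (ComplexShape.up (ZMod m)) j).obj X) =
      - k0Class ((single A (ComplexShape.up (ZMod m)) i).obj X) := by
  rw [eq_neg_iff_add_eq_zero, add_comm, ← eq_neg_iff_add_eq_zero]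
  refine k0Class_eq_neg_of_iso (fun _ _ => rfl) (fun _ _ => rfl) fun l => ?_
  by_cases hl : l = i
  · exact singleObjXIsoOfEq _ i X l hl ≪≫
      (singleObjXIsoOfEq _ j X (l + 1) (by rw [hl, h])).symm
  · exact (isZero_single_obj_X _ _ _ _ hl).iso
      (isZero_single_obj_X _ _ _ _ fun h' => hl (add_right_cancel (h'.trans h.symm)))

lemma k0Class_single_natCast (X : A) (a : ℕ) :
    k0Class ((single A (ComplexShape.up (ZMod m)) (a : ZMod m)).obj X) =
      (-1 : ℤ) ^ a • k0Class ((single A (ComplexShape.up (ZMod m)) 0).obj X) := by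
  induction a with
  | zero => simp
  | succ a ih => rw [k0Class_single X a _ (by simp), ih, pow_succ]; simp

/-- For odd `m`, shifting `m` times shows that a stalk complex has a class of order at most two. -/
lemma two_smul_k0Class_single (hm : Odd m) (X : A) :
    (2 : ℤ) • k0Class ((single A (ComplexShape.up (ZMod m)) 0).obj X) = 0 := by
  have h := k0Class_single_natCast (m := m) X m
  rw [hm.neg_one_pow, ZMod.natCast_self, neg_one_smul] at h
  rw [two_smul]
  nth_rewrite 1 [h]
  simp

end PeriodicComplex

/-- Every object of the periodic derived category comes from a periodic complex, so that classes
of complexes generate the Grothendieck group. -/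
lemma k0_eq_top_of_k0Class_mem (H : AddSubgroup (TriangulatedK0 (exactTriangles A m)))
    (h : ∀ K : PeriodicComplex A m, K.k0Class ∈ H) : H = ⊤ := by
  rw [eq_top_iff]
  rintro x -
  obtain ⟨y, rfl⟩ := QuotientAddGroup.mk_surjective x
  induction y using FreeAbelianGroup.induction_on with
  | zero => exact H.zero_mem
  | of q =>
    obtain ⟨X, rfl⟩ := Quotient.mk_surjective q
    have := Localization.essSurj (HomotopyCategory.quasiIso A (ComplexShape.up (ZMod m))).Q
      (HomotopyCategory.quasiIso A (ComplexShape.up (ZMod m)))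
    obtain ⟨K, hK⟩ := HomotopyCategory.quotient_obj_surjective
      ((HomotopyCategory.quasiIso A (ComplexShape.up (ZMod m))).Q.objPreimage X)
    have e : X ≅ PeriodicComplex.toDerived K := by
      unfold PeriodicComplex.toDerived
      rw [hK]
      exact ((HomotopyCategory.quasiIso A (ComplexShape.up (ZMod m))).Q.objObjPreimageIso X).symm
    have hX := h K
    rwa [PeriodicComplex.k0Class, ← derivedClass_eq_of_iso e] at hX
  | neg q hq => exact H.neg_mem hq
  | add x y hx hy => exact H.add_mem hx hy

end GrothendieckGroupOfPeriodicDerivedCategory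

/-! ### Periodic complexes of finitely generated modules -/

section FinitelyGeneratedModules

variable {Λ : Type u} [Ring Λ]

lemma FGModuleCat.isZero_of_subsingleton (X : FGModuleCat.{u} Λ) [Subsingleton X] : IsZero X := by
  rw [IsZero.iff_id_eq_zero]
  ext x
  exact Subsingleton.elim (α := X) _ _

variable [IsArtinianRing Λ] [IsNoetherianRing Λ]

lemma FGModuleCat.isFiniteLength (X : FGModuleCat.{u} Λ) : IsFiniteLength Λ X :=
  isFiniteLength_iff_isNoetherian_isArtinian.2 ⟨inferInstance, inferInstance⟩

lemma FGModuleCat.compositionFactors_of_iso {X Y : FGModuleCat.{u} Λ} (e : X ≅ Y) :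
    compositionFactors Λ X = compositionFactors Λ Y :=
  ((hasFactors_compositionFactors X.isFiniteLength).congr
    (FGModuleCat.isoToLinearEquiv e)).unique (hasFactors_compositionFactors Y.isFiniteLength)

lemma FGModuleCat.compositionFactors_of_isZero {X : FGModuleCat.{u} Λ} (hX : IsZero X) :
    compositionFactors Λ X = 0 := by
  have : Subsingleton X := ⟨fun x y => by
    have h := congrArg (fun f => f.hom.hom) (hX.eq_of_src (𝟙 X) 0)
    exact (LinearMap.congr_fun h x).trans (LinearMap.congr_fun h y).symm⟩
  exact (hasFactors_compositionFactors X.isFiniteLength).unique .zero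

lemma FGModuleCat.compositionFactors_of_shortExact {S : ShortComplex (FGModuleCat.{u} Λ)}
    (hS : S.ShortExact) :
    compositionFactors Λ S.X₂ = compositionFactors Λ S.X₁ + compositionFactors Λ S.X₃ := by
  have h := hS.map_of_exact (forget₂ (FGModuleCat.{u} Λ) (ModuleCat.{u} Λ))
  exact compositionFactors_of_exact S.X₂.isFiniteLength S.f.hom.hom S.g.hom.hom
    ((ModuleCat.mono_iff_injective _).1 h.mono_f)
    (fun x => ((ShortComplex.ShortExact.moduleCat_exact_iff_function_exact _).1 h.exact) x)
    ((ModuleCat.epi_iff_surjective _).1 h.epi_g)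

open Classical in
/-- The function sending a module to its composition multiplicities is additive. -/
lemma isAdditiveOnShortExact_count (k : Type*) [Ring k] :
    IsAdditiveOnShortExact fun (X : FGModuleCat.{u} Λ) (c : SimpleModuleClasses Λ) =>
      ((compositionFactors Λ X).count c : k) := by
  intro S hS
  ext c
  simp [FGModuleCat.compositionFactors_of_shortExact hS]

variable {m : ℕ}

/-- A nonzero periodic complex has a nonzero cocycle, hence a simple submodule consisting of
cocycles. -/
lemma exists_simple_cocycles (K : PeriodicComplex (FGModuleCat.{u} Λ) m) (hK : ¬ IsZero K) :
    ∃ (i : ZMod m) (T : Submodule Λ (K.X i)), IsSimpleModule Λ T ∧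
      T ≤ LinearMap.ker (K.d i (i + 1)).hom.hom := by
  obtain ⟨i, hi⟩ : ∃ i, LinearMap.ker (K.d i (i + 1)).hom.hom ≠ ⊥ := by
    by_contra! h
    -- If all differentials are injective, then `d ∘ d = 0` forces `K = 0`.
    refine hK (K.isZero_of_isZero_X fun i => ?_)
    have : Subsingleton (K.X i) := ⟨fun x y => by
      refine LinearMap.ker_eq_bot.1 (h i) (LinearMap.ker_eq_bot.1 (h (i + 1)) ?_)
      have hd := congrArg (fun f => f.hom.hom) (K.d_comp_d i (i + 1) (i + 1 + 1))
      exact (LinearMap.congr_fun hd x).trans (LinearMap.congr_fun hd y).symm⟩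
    exact FGModuleCat.isZero_of_subsingleton _
  obtain ⟨T, hT, hle⟩ := (IsAtomic.eq_bot_or_exists_atom_le
    (LinearMap.ker (K.d i (i + 1)).hom.hom)).resolve_left hi
  exact ⟨i, T, isSimpleModule_iff_isAtom.2 hT, hle⟩

/-- Dévissage: splitting off one simple stalk complex at a time, every periodic complex has a
class in the subgroup generated by the classes of simple stalk complexes. -/
lemma k0Class_mem_of_single_mem [NeZero m]
    (H : AddSubgroup (TriangulatedK0 (PeriodicDerivedCategory.exactTriangles
      (FGModuleCat.{u} Λ) m)))
    (h : ∀ (i : ZMod m) (T : FGModuleCat.{u} Λ), IsSimpleModule Λ T →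
      PeriodicComplex.k0Class ((single _ (ComplexShape.up (ZMod m)) i).obj T) ∈ H)
    (K : PeriodicComplex (FGModuleCat.{u} Λ) m) : PeriodicComplex.k0Class K ∈ H := by
  induction hn : ∑ i, Multiset.card (compositionFactors Λ (K.X i)) using Nat.strong_induction_on
    generalizing K with
  | _ n ih =>
  -- The induction is on the sum of the lengths of the modules `Kⁱ`.
  by_cases hK : IsZero K
  · rw [PeriodicComplex.k0Class_of_isZero hK]
    exact H.zero_mem
  obtain ⟨i, T, hT, hle⟩ := exists_simple_cocycles K hK
  let f : FGModuleCat.of Λ T ⟶ K.X i := FGModuleCat.ofHom T.subtype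
  have hf : Mono f := ConcreteCategory.mono_of_injective _ T.injective_subtype
  let φ : (single _ (ComplexShape.up (ZMod m)) i).obj (FGModuleCat.of Λ T) ⟶ K :=
    mkHomFromSingle f fun j hj => by
      obtain rfl : i + 1 = j := hj
      ext x
      exact hle x.2
  have hφ : Mono φ := mono_of_mono_f _ fun j => by
    by_cases hj : j = i
    · subst hj
      rw [mkHomFromSingle_f]
      infer_instance
    · exact ⟨fun _ _ _ => (isZero_single_obj_X _ _ _ _ hj).eq_of_tgt _ _⟩
  have hS : (ShortComplex.mk φ (cokernel.π φ) (cokernel.condition φ)).ShortExact :=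
    { exact := ShortComplex.exact_cokernel φ }
  rw [PeriodicComplex.k0Class_of_shortExact hS]
  refine H.add_mem (h i _ hT) (ih _ ?_ _ rfl)
  have hfac (j : ZMod m) : compositionFactors Λ (K.X j) =
      compositionFactors Λ (((single _ (ComplexShape.up (ZMod m)) i).obj (FGModuleCat.of Λ T)).X j) +
        compositionFactors Λ ((cokernel φ).X j) := FGModuleCat.compositionFactors_of_shortExact
    ((shortExact_iff_degreewise_shortExact _).1 hS j)
  rw [← hn, Finset.sum_congr rfl fun j _ => (congrArg Multiset.card (hfac j)).trans
    (Multiset.card_add _ _), Finset.sum_add_distrib, lt_add_iff_pos_left]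
  refine Finset.sum_pos' (fun _ _ => Nat.zero_le _) ⟨i, Finset.mem_univ i, ?_⟩
  rw [FGModuleCat.compositionFactors_of_iso (singleObjXSelf (ComplexShape.up (ZMod m)) i _),
    compositionFactors_simple hT]
  simp

variable (Λ m) in
/-- Let `k` be a quotient ring of `ℤ` containing signs `ε` that alternate along `ℤ/m`. If integers
vanishing in `k` kill all stalk complexes in degree zero, then the Grothendieck group is free over
`k` on the simple modules: the classes of simple stalk complexes generate, and Euler characteristics
of multiplicities separate them. -/
theorem nonempty_k0_addEquiv [NeZero m] (k : Type) [Ring k] (ε : ZMod m → k)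
    (hε : ∀ i, ε (i + 1) = - ε i) (hε₀ : ε 0 = 1)
    (hk : Function.Surjective (Int.cast : ℤ → k))
    (htors : ∀ a : ℤ, (a : k) = 0 → ∀ X : FGModuleCat.{u} Λ,
      a • PeriodicComplex.k0Class ((single _ (ComplexShape.up (ZMod m)) 0).obj X) = 0) :
    Nonempty (TriangulatedK0 (PeriodicDerivedCategory.exactTriangles (FGModuleCat.{u} Λ) m) ≃+
      (SimpleModuleClasses Λ → k)) := by
  classical
  have := finite_simpleModuleClasses Λ
  have := Fintype.ofFinite (SimpleModuleClasses Λ)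
  have hsimple (c : SimpleModuleClasses Λ) : IsSimpleModule Λ c.out.1 := c.out.2
  let X (c : SimpleModuleClasses Λ) : FGModuleCat.{u} Λ := FGModuleCat.of Λ c.out.1
  let s (c : SimpleModuleClasses Λ) :=
    PeriodicComplex.k0Class ((single _ (ComplexShape.up (ZMod m)) 0).obj (X c))
  let χ := eulerCharacteristic (isAdditiveOnShortExact_count (Λ := Λ) k) ε hε
  have hχ (c : SimpleModuleClasses Λ) : χ (s c) = Pi.single c 1 := by
    refine (PeriodicComplex.eulerCharacteristic_k0Class _ ε hε _).trans ?_
    rw [Finset.sum_eq_single (0 : ZMod m) (fun i _ hi => ?_) (by simp), hε₀, one_smul]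
    · ext c'
      rw [FGModuleCat.compositionFactors_of_iso (singleObjXSelf (ComplexShape.up (ZMod m)) 0 _),
        compositionFactors_simple (hsimple c)]
      have hc : simpleClass c.out.1 (hsimple c) = c := c.out_eq
      rw [hc, Multiset.count_singleton, Pi.single_apply]
      split_ifs <;> simp
    · rw [FGModuleCat.compositionFactors_of_isZero (isZero_single_obj_X _ _ _ _ hi)]
      ext
      simp
  -- Integral combinations of the classes of the simple stalk complexes.
  let ψ : (SimpleModuleClasses Λ → ℤ) →+ _ :=
    { toFun := fun a => ∑ c, a c • s c
      map_zero' := by simp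
      map_add' := fun a b => by simp [add_smul, Finset.sum_add_distrib] }
  have hψ : ψ.range = ⊤ := by
    refine k0_eq_top_of_k0Class_mem _ (k0Class_mem_of_single_mem _ fun i T hT => ?_)
    rw [← ZMod.natCast_zmod_val i, PeriodicComplex.k0Class_single_natCast]
    refine AddSubgroup.zsmul_mem _ ?_ _
    obtain ⟨e⟩ := Quotient.exact (simpleClass T hT).out_eq
    have e' : T ≅ X (simpleClass T hT) := (LinearEquiv.toFGModuleCatIso e).symm
    rw [PeriodicComplex.k0Class_eq_of_iso ((single _ (ComplexShape.up (ZMod m)) 0).mapIso e')]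
    exact ⟨Pi.single (simpleClass T hT) 1, by simp [ψ, s, Pi.single_apply]⟩
  have hχψ (a : SimpleModuleClasses Λ → ℤ) : χ (ψ a) = fun c => (a c : k) := by
    ext c
    simp [ψ, hχ, Pi.single_apply]
  refine ⟨AddEquiv.ofBijective χ ⟨(injective_iff_map_eq_zero _).2 fun x hx => ?_, fun b => ?_⟩⟩
  · obtain ⟨a, rfl⟩ := AddMonoidHom.range_eq_top.1 hψ x
    rw [hχψ] at hx
    exact Finset.sum_eq_zero fun c _ => htors _ (congrFun hx c) _
  · choose a ha using fun c => hk (b c)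
    exact ⟨ψ a, by rw [hχψ]; exact funext ha⟩

lemma neg_one_pow_val_add_one [NeZero m] (hm : Even m) (i : ZMod m) :
    (-1 : ℤ) ^ (i + 1).val = - (-1) ^ i.val := by
  rw [ZMod.val_add, ZMod.val_one_eq_one_mod, Nat.add_mod_mod, neg_one_pow_eq_pow_mod_two,
    Nat.mod_mod_of_dvd _ hm.two_dvd, ← neg_one_pow_eq_pow_mod_two, pow_succ]
  simp

end FinitelyGeneratedModules

theorem corollary1p2 (R : Type v) [CommRing R] [IsArtinianRing R]
    (Λ : Type u) [Ring Λ] [Algebra R Λ] [Module.Finite R Λ]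
    (hΛ : haveI : IsNoetherianRing Λ := IsNoetherianRing.of_finite R Λ
      HasFiniteGlobalDimension (FGModuleCat.{u} Λ))
    (n : ℕ) (hn : Nat.card (SimpleModuleClasses Λ) = n)
    (m : ℕ) (hm : 0 < m) :
    haveI : IsNoetherianRing Λ := IsNoetherianRing.of_finite R Λ
    (Even m → Nonempty
      (TriangulatedK0 (PeriodicDerivedCategory.exactTriangles (FGModuleCat.{u} Λ) m) ≃+
        (Fin n → ℤ))) ∧
    (Odd m → Nonempty
      (TriangulatedK0 (PeriodicDerivedCategory.exactTriangles (FGModuleCat.{u} Λ) m) ≃+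
        (Fin n → ZMod 2))) := by
  have : IsNoetherianRing Λ := IsNoetherianRing.of_finite R Λ
  have : IsArtinianRing Λ := IsArtinianRing.of_finite R Λ
  have : NeZero m := ⟨hm.ne'⟩
  have := finite_simpleModuleClasses Λ
  let e : SimpleModuleClasses Λ ≃ Fin n := Finite.equivFinOfCardEq hn
  refine ⟨fun h => ?_, fun h => ?_⟩
  · obtain ⟨χ⟩ := nonempty_k0_addEquiv Λ m ℤ (fun i => (-1) ^ i.val)
      (neg_one_pow_val_add_one h) (by simp) (fun a => ⟨a, rfl⟩) (by simp)
    exact ⟨χ.trans (LinearEquiv.funCongrLeft ℤ ℤ e.symm).toAddEquiv⟩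
  · obtain ⟨χ⟩ := nonempty_k0_addEquiv Λ m (ZMod 2) (fun _ => 1) (fun _ => rfl) rfl
      (ZMod.intCast_surjective) (fun a ha X => by
        obtain ⟨b, rfl⟩ := (ZMod.intCast_zmod_eq_zero_iff_dvd a 2).1 ha
        rw [mul_comm, mul_smul]
        erw [PeriodicComplex.two_smul_k0Class_single h, smul_zero])
    exact ⟨χ.trans (LinearEquiv.funCongrLeft ℤ (ZMod 2) e.symm).toAddEquiv⟩
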